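/- **Setting.** A many-vs-one distinguishing problem $T=(x_A,\mathcal X_R,\mathcal X)$ consists of an instance set $\mathcal X$, a reject set $\mathcal X_R\subset\mathcal X$ and an accept instance $x_A\in\mathcal X\setminus\mathcal X_R$. On $x_A$ only "accept" is a valid solution, on $x\in\mathcal X_R$ only "reject", and on every other instance both are valid. An oracle takes a classical query together with a finite-dimensional quantum register, applies a quantum operation with finitely many outcomes to the register (which may depend on the query and on the earlier queries and answers), and returns the register and a classical answer. An access model $\mathsf O$ assigns to every $x\in\mathcal X$ the set $\mathsf O(x)$ of legitimate oracles for $x$; a statement about access to $\mathsf O(x)$ is required for each of them. Algorithms, verifiers and provers are computationally unbounded: they have a finite-dimensional quantum register of any size and unbounded classical memory, apply arbitrary quantum operations with finitely many outcomes, act adaptively, and always halt. Verifier and prover exchange classical messages and a finite-dimensional quantum message register. An algorithm solves $T$ from $\mathsf O$-access with probability $\ge 1-\delta$ if, for every $x\in\mathcal X$, it outputs a valid solution with probability $\ge 1-\delta$ when given access to $\mathsf O(x)$. A pair $(V,P)$ is an interactive proof system for $T$ with success probability $1-\delta$ from $(\mathsf O_V,\mathsf O_P)$-access if for every $x\in\mathcal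 X$: (completeness) when $V$ with access to $\mathsf O_V(x)$ interacts with $P$ with access to $\mathsf O_P(x)$, then with probability $\ge 1-\delta$ the verifier does not abort and outputs a valid solution; (soundness) when $V$ with access to $\mathsf O_V(x)$ interacts with an arbitrary prover $P'$, then with probability $<\delta$ the verifier does not abort and outputs an invalid solution. "At most $n$ queries" means that, for every instance, the probability of making more than $n$ queries is $0$ (for $V$: in the interaction with the honest prover $P$). **Corollary 3.** Let $T=(x_A,\mathcal X_R,\mathcal X)$ be any many-vs-one distinguishing problem, let $\mathsf O_V$ and $\mathsf O_P$ be any access models such that $\mathsf O_P(x_A)$ contains some oracle (in particular, $\mathsf O_P$ may be stronger than $\mathsf O_V$), and let $\delta\in\mathbb R$, $n\in\mathbb N$. If there is an interactive proof system $(V,P)$ for $T$ with success probability $1-\delta$ from $(\mathsf O_V,\mathsf O_P)$-access in which $V$ makes at most $n$ queries to $\mathsf O_V$, then some algorithm without a prover solves $T$ from $\mathsf O_V$-access with probability $\ge 1-\delta$ and at most $n$ queries. Moreover, if the oracles of $\mathsf O_V$ are classical (their quantum register is one-dimensional), this algorithm can be taken to be classical and randomised. Consequently, for all $\tau\ge 0$,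 $\delta\in\mathbb R$ and $n\in\mathbb N$, whenever one of the following problems has an interactive proof system with success probability $1-\delta$ from the indicated access in which $V$ makes at most $n$ queries, then a classical randomised algorithm solves it, without a prover, from the access of $V$ with probability $\ge 1-\delta$ and at most $n$ queries. 1. *Parity testing* $(U_{k+1},\{D_s : s\in\{0,1\}^k\},\mathcal D_{k+1})$, $k\ge 0$, where $\mathcal D_{k+1}$ is the set of probability distributions on $\{0,1\}^{k+1}$, $U_{k+1}$ is the uniform one, and $D_s$ is the distribution of $(x, s\cdot x \bmod 2)$ for uniform $x\in\{0,1\}^k$. $V$ has statistical query access to the unknown distribution $D$ (a query $\varphi:\{0,1\}^{k+1}\to[-1,1]$ is answered by an arbitrary number within $\tau$ of $\mathbb E_D[\varphi]$), and $P$ has access to independent samples from $D$. 2. *Purity testing*: the maximally mixed state $\mathbb 1/d$ versus all pure states, within all states of dimension $d\ge 2$. $V$ has quantum statistical query access to the unknown state $\rho$ (an observable $M$ with $\|M\|\le 1$ is answered by an arbitrary number within $\tau$ of $\mathrm{tr}(M\rho)$), and $P$ has access to copies of $\rho$. 3. *Stabilizer testing*: the maximally mixed state versus the pure stabilizer states,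 within all states of $k\ge 1$ qubits, with the same access as in 2. 4. *Quadratic function testing*: the maximally mixed state versus the states $|\psi_A\rangle = 2^{-k/2}\sum_{x\in\mathbb F_2^k}|x, x^{\mathsf T}Ax\rangle$ with $A\in\mathbb F_2^{k\times k}$, within all states of $k+1$ qubits, $k\ge 0$, with the same access as in 2. -/

import Mathlib

open Matrix
open scoped Kronecker ComplexOrder

noncomputable section

namespace InteractiveTesting

/-! ## Many-vs-one distinguishing problems -/

/-- The two possible answers to a testing problem. -/
inductive Decision where
  | accept
  | reject

/-- A many-vs-one distinguishing problem `(x_A, X_R, X)` on the instance set `X`. -/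
structure ManyVsOne (X : Type*) where
  accept : X
  reject : Set X
  accept_notMem : accept ∉ reject

/-- Valid solutions: only "accept" on `x_A`, only "reject" on `X_R`, both on all other instances. -/
def ManyVsOne.Valid {X : Type*} (T : ManyVsOne X) : Decision → X → Prop
  | .accept, x => x ∉ T.reject
  | .reject, x => x ≠ T.accept

/-! ## Quantum operations, oracles and non-interactive algorithms

Quantum registers are finite dimensional and are given by their finite set of basis labels.
States are carried along unnormalised: the trace is the probability of the branch. -/

/-- Density matrices on the register `a`. -/
def IsDensity {a : Type} [Fintype a] (ρ : Matrix a a ℂ) : Prop :=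
  ρ.PosSemidef ∧ ρ.trace = 1

/-- A general quantum operation with finitely many outcomes, in Kraus form. Coarser outcomes are
obtained by treating several outcomes alike; unitaries have one outcome, and on a one-dimensional
register this is a coin with finitely many faces. -/
structure Measurement (a : Type) [Fintype a] [DecidableEq a] where
  arity : ℕ
  kraus : Fin arity → Matrix a a ℂ
  complete : ∑ i, (kraus i)ᴴ * kraus i = 1

/-- The (unnormalised) state after the Kraus operator `K`. -/
def applyKraus {t : Type} [Fintype t] (K ρ : Matrix t t ℂ) : Matrix t t ℂ := K * ρ * Kᴴ

/-- The type of an oracle: classical queries, classical answers, and a quantum register that the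
caller hands over with the query and receives back with the answer. -/
structure Interface where
  Query : Type
  Answer : Type
  Reg : Type
  [fintypeReg : Fintype Reg]
  [decEqReg : DecidableEq Reg]

attribute [instance] Interface.fintypeReg Interface.decEqReg

/-- A quantum operation on the oracle register whose outcomes are announced as classical answers. -/
structure Response (I : Interface) extends Measurement I.Reg where
  label : Fin arity → I.Answer

/-- A record of the queries made so far with their answers, latest first. -/
abbrev History (I : Interface) := List (I.Query × I.Answer)

/-- A concrete oracle: how it responds to a query, given the earlier queries and answers. -/
abbrev Oracle (I : Interface) := History I → I.Query → Response I

/-- An access model assigns to each instance `x` the set of concrete oracles that are legitimate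
for `x` (several for statistical queries, whose answers are only constrained up to a tolerance). -/
abbrev AccessModel (I : Interface) (X : Type*) := X → Set (Oracle I)

/-- Programs that operate on a quantum register `a`, keep unbounded classical memory (the position
in the tree), may query an oracle, and finally return an element of `L`. -/
inductive Program (I : Interface) (a : Type) [Fintype a] [DecidableEq a] (L : Type) : Type
  | done (x : L) : Program I a L
  | measure (M : Measurement a) (next : Fin M.arity → Program I a L) : Program I a L
  | query (q : I.Query) (next : I.Answer → Program I a L) : Program I a L

/-- Run a program as part of a larger system with register `t`. The maps `act` and `oact` embed the
operators on the program's register, and on its oracle register, into those on `t`; the value `k`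
is collected at the end of each branch and summed over all branches. -/
def Program.eval {I : Interface} {a t L : Type} [Fintype a] [DecidableEq a] [Fintype t]
    (O : Oracle I) (act : Matrix a a ℂ → Matrix t t ℂ)
    (oact : Matrix I.Reg I.Reg ℂ → Matrix t t ℂ)
    (k : L → History I → Matrix t t ℂ → ℝ) :
    Program I a L → History I → Matrix t t ℂ → ℝ
  | .done x, h, ρ => k x h ρ
  | .measure M next, h, ρ =>
      ∑ i, (next i).eval O act oact k h (applyKraus (act (M.kraus i)) ρ)
  | .query q next, h, ρ =>
      ∑ j, (next ((O h q).label j)).eval O act oact k ((q, (O h q).label j) :: h)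
        (applyKraus (oact ((O h q).kraus j)) ρ)

/-- A non-interactive (randomised or quantum) algorithm with oracle access and no computational
constraints: a private register next to the oracle register, an initial state, and a program. -/
structure Algorithm (I : Interface) where
  Work : Type
  [fintypeWork : Fintype Work]
  [decEqWork : DecidableEq Work]
  start : Matrix (Work × I.Reg) (Work × I.Reg) ℂ
  isDensity : IsDensity start
  program : Program I (Work × I.Reg) Decision

attribute [instance] Algorithm.fintypeWork Algorithm.decEqWork

/-- A classical randomised algorithm: it has no quantum register besides the trivial one. -/
def Algorithm.IsClassical {I : Interface} (A : Algorithm I) : Prop :=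
  Subsingleton (A.Work × I.Reg)

open Classical in
/-- The probability that the output `d` of `A` with oracle `O`, and the number `m` of queries
that `A` has made, satisfy `E d m`. -/
def Algorithm.prob {I : Interface} (A : Algorithm I) (O : Oracle I)
    (E : Decision → ℕ → Prop) : ℝ :=
  A.program.eval O (fun K => K) (fun K => (1 : Matrix A.Work A.Work ℂ) ⊗ₖ K)
    (fun d h ρ => if E d h.length then ρ.trace.re else 0) [] A.start

/-! ## Interaction -/

/-- The communication channel between verifier and prover: classical messages in both directions
(`Up`: to the prover, `Down`: to the verifier) and a quantum register that is passed back and forth.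
Purely classical communication is the case of a one-dimensional register. -/
structure Channel where
  Up : Type
  Down : Type
  Reg : Type
  [fintypeReg : Fintype Reg]
  [decEqReg : DecidableEq Reg]

attribute [instance] Channel.fintypeReg Channel.decEqReg

/-- Verifier programs: as `Program`, but the program may also send a message to the prover and wait
for the reply, and it stops with a decision (`some d`) or aborts (`none`). -/
inductive VerifierProgram (I : Interface) (C : Channel) (a : Type) [Fintype a] [DecidableEq a] :
    Type
  | halt (v : Option Decision) : VerifierProgram I C a
  | measure (M : Measurement a) (next : Fin M.arity → VerifierProgram I C a) :
      VerifierProgram I C a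
  | query (q : I.Query) (next : I.Answer → VerifierProgram I C a) : VerifierProgram I C a
  | send (c : C.Up) (next : C.Down → VerifierProgram I C a) : VerifierProgram I C a

/-- A verifier holds a private register, its oracle register and, at the start, the message
register. -/
structure Verifier (I : Interface) (C : Channel) where
  Work : Type
  [fintypeWork : Fintype Work]
  [decEqWork : DecidableEq Work]
  start : Matrix ((Work × I.Reg) × C.Reg) ((Work × I.Reg) × C.Reg) ℂ
  isDensity : IsDensity start
  program : VerifierProgram I C ((Work × I.Reg) × C.Reg)

attribute [instance] Verifier.fintypeWork Verifier.decEqWork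

/-- A prover holds a private register and its oracle register, and has a classical memory `Mem`.
Upon each message it runs a program on the message register and its own registers, which ends in a
new content of its classical memory and a reply. -/
structure Prover (J : Interface) (C : Channel) where
  Work : Type
  [fintypeWork : Fintype Work]
  [decEqWork : DecidableEq Work]
  start : Matrix (Work × J.Reg) (Work × J.Reg) ℂ
  isDensity : IsDensity start
  Mem : Type
  init : Mem
  turn : Mem → C.Up → Program J (C.Reg × (Work × J.Reg)) (Mem × C.Down)

attribute [instance] Prover.fintypeWork Prover.decEqWork

/-- The joint register of verifier (private, oracle), channel, and prover (private, oracle). -/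
abbrev Joint (W : Type) (I : Interface) (C : Channel) {J : Interface} (P : Prover J C) : Type :=
  ((W × I.Reg) × C.Reg) × (P.Work × J.Reg)

open Classical in
/-- The probability that the final verdict `v` of the verifier, and the total number `m` of its
oracle queries, satisfy `E v m`, when the remaining verifier program interacts with the prover `P`.
Arguments: the verifier's query history, the prover's memory and query history, the joint state. -/
def VerifierProgram.eval {I J : Interface} {C : Channel} {W : Type} [Fintype W] [DecidableEq W]
    (OV : Oracle I) (P : Prover J C) (OP : Oracle J) (E : Option Decision → ℕ → Prop) :
    VerifierProgram I C ((W × I.Reg) × C.Reg) → History I → P.Mem → History J →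
      Matrix (Joint W I C P) (Joint W I C P) ℂ → ℝ
  | .halt v, h, _, _, ρ => if E v h.length then ρ.trace.re else 0
  | .measure M next, h, s, g, ρ =>
      ∑ i, (next i).eval OV P OP E h s g
        (applyKraus (M.kraus i ⊗ₖ (1 : Matrix (P.Work × J.Reg) (P.Work × J.Reg) ℂ)) ρ)
  | .query q next, h, s, g, ρ =>
      ∑ j, (next ((OV h q).label j)).eval OV P OP E ((q, (OV h q).label j) :: h) s g
        (applyKraus ((((1 : Matrix W W ℂ) ⊗ₖ (OV h q).kraus j) ⊗ₖ (1 : Matrix C.Reg C.Reg ℂ)) ⊗ₖ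
          (1 : Matrix (P.Work × J.Reg) (P.Work × J.Reg) ℂ)) ρ)
  | .send c next, h, s, g, ρ =>
      (P.turn s c).eval OP
        (fun K => ((1 : Matrix (W × I.Reg) (W × I.Reg) ℂ) ⊗ₖ K).submatrix
          (Equiv.prodAssoc (W × I.Reg) C.Reg (P.Work × J.Reg))
          (Equiv.prodAssoc (W × I.Reg) C.Reg (P.Work × J.Reg)))
        (fun K => (1 : Matrix ((W × I.Reg) × C.Reg) ((W × I.Reg) × C.Reg) ℂ) ⊗ₖ
          ((1 : Matrix P.Work P.Work ℂ) ⊗ₖ K))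
        (fun r g' ρ' => (next r.2).eval OV P OP E h r.1 g' ρ') g ρ

/-- The probability of the event `E` on verdict and number of verifier queries, when `V` with
oracle `OV` interacts with `P` with oracle `OP`. -/
def Verifier.prob {I J : Interface} {C : Channel} (V : Verifier I C) (OV : Oracle I)
    (P : Prover J C) (OP : Oracle J) (E : Option Decision → ℕ → Prop) : ℝ :=
  V.program.eval OV P OP E [] P.init [] (V.start ⊗ₖ P.start)

/-! ## Solving a problem alone and by an interactive proof -/

section Tasks

variable {X : Type*} {I J : Interface} {C : Channel}

/-- `A` solves the problem from `acc`-access with probability at least `1 - δ`. -/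
def Algorithm.Solves (A : Algorithm I) (T : ManyVsOne X) (acc : AccessModel I X) (δ : ℝ) : Prop :=
  ∀ x, ∀ O ∈ acc x, 1 - δ ≤ A.prob O (fun d _ => T.Valid d x)

/-- On no instance does `A` ever make more than `n` queries. -/
def Algorithm.QueriesAtMost (A : Algorithm I) (acc : AccessModel I X) (n : ℕ) : Prop :=
  ∀ x, ∀ O ∈ acc x, A.prob O (fun _ m => n < m) = 0

/-- `(V, P)` is an interactive proof system for the problem, with success probability `1 - δ`,
from `(accV, accP)`-access. The adversarial prover is arbitrary, with any oracle whatsoever. -/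
structure IsInteractiveProof (T : ManyVsOne X) (accV : AccessModel I X) (accP : AccessModel J X) (δ : ℝ)
    (V : Verifier I C) (P : Prover J C) : Prop where
  completeness : ∀ x, ∀ OV ∈ accV x, ∀ OP ∈ accP x,
    1 - δ ≤ V.prob OV P OP (fun v _ => ∃ d, v = some d ∧ T.Valid d x)
  soundness : ∀ x, ∀ OV ∈ accV x, ∀ (J' : Interface) (P' : Prover J' C) (OP' : Oracle J'),
    V.prob OV P' OP' (fun v _ => ∃ d, v = some d ∧ ¬ T.Valid d x) < δ

/-- On no instance does `V` ever make more than `n` oracle queries when interacting with the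
honest prover `P`. -/
def Verifier.QueriesAtMost (V : Verifier I C) (P : Prover J C) (accV : AccessModel I X)
    (accP : AccessModel J X) (n : ℕ) : Prop :=
  ∀ x, ∀ OV ∈ accV x, ∀ OP ∈ accP x, V.prob OV P OP (fun _ m => n < m) = 0

/-- Some algorithm solves the problem in isolation with at most `n` queries. -/
def SolvableWithin (T : ManyVsOne X) (accV : AccessModel I X) (δ : ℝ) (n : ℕ) : Prop :=
  ∃ A : Algorithm I, A.Solves T accV δ ∧ A.QueriesAtMost accV n

/-- Some classical randomised algorithm solves the problem in isolation with at most `n` queries. -/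
def ClassicallySolvableWithin (T : ManyVsOne X) (accV : AccessModel I X) (δ : ℝ) (n : ℕ) : Prop :=
  ∃ A : Algorithm I, A.IsClassical ∧ A.Solves T accV δ ∧ A.QueriesAtMost accV n

/-- Some interactive proof system for the problem has a verifier that makes at most `n` queries. -/
def VerifiableWithin (T : ManyVsOne X) (accV : AccessModel I X) (accP : AccessModel J X) (δ : ℝ)
    (n : ℕ) : Prop :=
  ∃ (C : Channel) (V : Verifier I C) (P : Prover J C),
    IsInteractiveProof T accV accP δ V P ∧ V.QueriesAtMost P accV accP n

end Tasks

/-! ## Access to an unknown distribution -/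

/-- Sample access: no input, the answer is an element of `Ω`. -/
abbrev sampleInterface (Ω : Type) : Interface where
  Query := Unit
  Answer := Ω
  Reg := Unit

/-- Each query is answered by an independent sample from `D`. -/
def sampleAccess (Ω : Type) [DecidableEq Ω] : AccessModel (sampleInterface Ω) (PMF Ω) :=
  fun D => {O | ∀ h q (ω : Ω),
    ∑ j, (if (O h q).label j = ω then ((O h q).kraus j)ᴴ * (O h q).kraus j else 0)
      = ((D ω).toReal : ℂ) • 1}

/-- Statistical queries: a query is a function with values in `[-1, 1]`, an answer is a number. -/
abbrev sqInterface (Ω : Type) : Interface where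
  Query := {φ : Ω → ℝ // ∀ ω, φ ω ∈ Set.Icc (-1) 1}
  Answer := ℝ
  Reg := Unit

/-- A query `φ` is answered by an arbitrary number within `τ` of the expectation of `φ`. -/
def sqAccess (Ω : Type) [Fintype Ω] (τ : ℝ) : AccessModel (sqInterface Ω) (PMF Ω) :=
  fun D => {O | ∀ h (φ : {φ : Ω → ℝ // ∀ ω, φ ω ∈ Set.Icc (-1) 1}) j,
    |(O h φ).label j - ∑ ω, (D ω).toReal * φ.1 ω| ≤ τ}

/-! ## Access to an unknown quantum state -/

/-- Quantum states on the register `a`. -/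
abbrev QState (a : Type) [Fintype a] := {ρ : Matrix a a ℂ // IsDensity ρ}

/-- Access to copies: no input, the oracle register is replaced by the unknown state. -/
abbrev copyInterface (a : Type) [Fintype a] [DecidableEq a] : Interface where
  Query := Unit
  Answer := Unit
  Reg := a

/-- Each query discards the content of the oracle register and puts a fresh copy of `ρ` there. -/
def copyAccess (a : Type) [Fintype a] [DecidableEq a] :
    AccessModel (copyInterface a) (QState a) :=
  fun ρ => {O | ∀ h q (Y : Matrix a a ℂ),
    ∑ j, applyKraus ((O h q).kraus j) Y = Y.trace • ρ.1}

/-- Quantum statistical queries: a query is (the classical description of) an observable `M` of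
operator norm at most one, that is `-1 ≤ M ≤ 1`, an answer is a number. -/
abbrev qsqInterface (a : Type) [DecidableEq a] : Interface where
  Query := {M : Matrix a a ℂ // (1 - M).PosSemidef ∧ (1 + M).PosSemidef}
  Answer := ℝ
  Reg := Unit

/-- A query `M` is answered by an arbitrary number within `τ` of `tr (M ρ)`. -/
def qsqAccess (a : Type) [Fintype a] [DecidableEq a] (τ : ℝ) :
    AccessModel (qsqInterface a) (QState a) :=
  fun ρ => {O | ∀ h (M : {M : Matrix a a ℂ // (1 - M).PosSemidef ∧ (1 + M).PosSemidef}) j,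
    |(O h M).label j - (M.1 * ρ.1).trace.re| ≤ τ}

/-! ## The concrete problems -/

/-- Bit strings of length `n`; also the basis labels of `n` qubits. -/
abbrev Bits (n : ℕ) := Fin n → ZMod 2

/-- The parity distribution `D_s`: a uniformly random `x` followed by `s · x` mod 2. -/
def parityDistribution {n : ℕ} (s : Bits n) : PMF (Bits (n + 1)) :=
  (PMF.uniformOfFintype (Bits n)).map
    (fun x => (Fin.snoc (α := fun _ => ZMod 2) x (s ⬝ᵥ x) : Bits (n + 1)))

/-- Parity testing: the uniform distribution versus the parity distributions. -/
def parityTesting (n : ℕ) : ManyVsOne (PMF (Bits (n + 1))) where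
  accept := PMF.uniformOfFintype (Bits (n + 1))
  reject := Set.range parityDistribution
  accept_notMem := by
    rintro ⟨s, hs⟩
    have h : (Fin.snoc (α := fun _ => ZMod 2) (0 : Bits n) 1 : Bits (n + 1)) ∈
        (parityDistribution s).support := by
      rw [hs]; simp
    rw [parityDistribution, PMF.mem_support_map_iff] at h
    obtain ⟨x, -, hx⟩ := h
    have h1 : x = 0 := by
      have := congrArg (fun y : Bits (n + 1) => Fin.init (α := fun _ => ZMod 2) y) hx
      simpa using this
    have h2 := congrFun hx (Fin.last n)
    subst h1
    simp at h2

/-- Pure states `|ψ⟩⟨ψ|`. -/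
def pureStates (a : Type) [Fintype a] : Set (QState a) :=
  {ρ | ∃ ψ : a → ℂ, ρ.1 = vecMulVec ψ (star ψ)}

/-- The maximally mixed state. -/
def maximallyMixed (a : Type) [Fintype a] [DecidableEq a] [Nonempty a] : QState a :=
  ⟨((Fintype.card a : ℂ)⁻¹) • 1, by
    refine ⟨(Matrix.PosSemidef.one (n := a) (R := ℂ)).smul (a := (Fintype.card a : ℂ)⁻¹) ?_, ?_⟩
    · exact inv_nonneg.mpr (Nat.cast_nonneg _)
    · simp [Matrix.trace_smul]⟩

theorem maximallyMixed_notMem_pureStates (a : Type) [Fintype a] [DecidableEq a] [Nontrivial a] :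
    maximallyMixed a ∉ pureStates a := by
  rintro ⟨ψ, hψ⟩
  obtain ⟨i, j, hij⟩ := exists_pair_ne a
  have hc : ((Fintype.card a : ℂ)⁻¹) ≠ 0 := by simp
  have hii := congrFun (congrFun hψ i) i
  have hjj := congrFun (congrFun hψ j) j
  have hij' := congrFun (congrFun hψ i) j
  simp only [maximallyMixed, Matrix.smul_apply, Matrix.one_apply_eq, Matrix.one_apply_ne hij,
    vecMulVec_apply, Pi.star_apply, smul_eq_mul, mul_one, mul_zero] at hii hjj hij'
  rcases mul_eq_zero.mp hij'.symm with h | h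
  · rw [h, zero_mul] at hii; exact hc hii
  · rw [h, mul_zero] at hjj; exact hc hjj

/-- Testing the maximally mixed state versus a class of pure states. -/
def mixedVersus (a : Type) [Fintype a] [DecidableEq a] [Nontrivial a] (S : Set (QState a))
    (hS : S ⊆ pureStates a) : ManyVsOne (QState a) where
  accept := maximallyMixed a
  reject := S
  accept_notMem := fun h => maximallyMixed_notMem_pureStates a (hS h)

/-- Purity testing in dimension `d`. -/
def purityTesting (d : ℕ) [Nontrivial (Fin d)] : ManyVsOne (QState (Fin d)) :=
  mixedVersus (Fin d) (pureStates (Fin d)) subset_rfl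

/-- The single-qubit Pauli matrices `1, X, Y, Z`. -/
def pauli : Fin 4 → Matrix (Fin 2) (Fin 2) ℂ :=
  ![!![1, 0; 0, 1], !![0, 1; 1, 0], !![0, -Complex.I; Complex.I, 0], !![1, 0; 0, -1]]

/-- The `n`-qubit Pauli operator `P_1 ⊗ ⋯ ⊗ P_n`. -/
def pauliString {n : ℕ} (p : Fin n → Fin 4) : Matrix (Bits n) (Bits n) ℂ :=
  Matrix.of fun x y => ∏ i, pauli (p i) (x i) (y i)

/-- Clifford unitaries: those that map Pauli operators to Pauli operators, up to sign, under
conjugation. -/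
def IsClifford {n : ℕ} (U : Matrix (Bits n) (Bits n) ℂ) : Prop :=
  U ∈ Matrix.unitaryGroup (Bits n) ℂ ∧
    ∀ p : Fin n → Fin 4, ∃ (q : Fin n → Fin 4) (ε : ℂ), (ε = 1 ∨ ε = -1) ∧
      U * pauliString p * Uᴴ = ε • pauliString q

/-- The pure stabilizer states: those of the form `U |0⋯0⟩` with `U` a Clifford unitary. -/
def stabilizerStates (n : ℕ) : Set (QState (Bits n)) :=
  {ρ | ∃ U : Matrix (Bits n) (Bits n) ℂ, IsClifford U ∧
    ρ.1 = vecMulVec (U *ᵥ Pi.single 0 1) (star (U *ᵥ Pi.single 0 1))}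

/-- Stabilizer testing on `n ≥ 1` qubits. -/
def stabilizerTesting (n : ℕ) [NeZero n] : ManyVsOne (QState (Bits n)) :=
  haveI : Nonempty (Fin n) := ⟨0⟩
  mixedVersus (Bits n) (stabilizerStates n) (fun _ ⟨U, _, h⟩ => ⟨U *ᵥ Pi.single 0 1, h⟩)

/-- The state vector `2^{-n/2} ∑_x |x, f(x)⟩` of the quadratic function `f(x) = xᵀ A x` over
the field with two elements. -/
def quadraticVector {n : ℕ} (A : Matrix (Fin n) (Fin n) (ZMod 2)) : Bits (n + 1) → ℂ :=
  fun z =>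
    if z (Fin.last n) = Fin.init (α := fun _ => ZMod 2) z ⬝ᵥ
        (A *ᵥ Fin.init (α := fun _ => ZMod 2) z)
    then ((Real.sqrt (2 ^ n))⁻¹ : ℝ) else 0

/-- The states that encode quadratic functions of `n` bits. -/
def quadraticStates (n : ℕ) : Set (QState (Bits (n + 1))) :=
  {ρ | ∃ A : Matrix (Fin n) (Fin n) (ZMod 2),
    ρ.1 = vecMulVec (quadraticVector A) (star (quadraticVector A))}

/-- Quadratic function testing. -/
def quadraticTesting (n : ℕ) : ManyVsOne (QState (Bits (n + 1))) :=
  mixedVersus (Bits (n + 1)) (quadraticStates n) (fun _ ⟨A, h⟩ => ⟨quadraticVector A, h⟩)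

end InteractiveTesting

end

open InteractiveTesting

/-!
A prover is of no use in a many-vs-one problem because the verifier only ever has to be convinced
of one instance: a lone algorithm can run the verifier against an imaginary honest prover whose
oracle is a fixed oracle for the accept instance `x_A`, whatever the actual instance is, and accept
exactly if the verifier accepts. On `x_A` this is the honest interaction, so completeness gives
acceptance with probability at least `1 - δ`. On a reject instance the imaginary prover is just some
cheating prover, so soundness bounds the probability of acceptance by `δ`. On all other instances
every output is valid. The honest prover bounds the number of queries only on `x_A`, so the
algorithm also stops with "reject" before its `(n+1)`-st query (`Program.cutoff`); on `x_A` this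
happens with probability zero, and elsewhere it can only lower the probability of acceptance.

Formally, `VerifierProgram.simulate` turns verifier and prover into one program, in which the
responses of the known oracle of the prover become measurements, and
`VerifierProgram.run_simulate` says that all probabilities are unchanged. The result is
`solvableWithin_of_verifiableWithin`.

If the oracle of the verifier is classical, its responses multiply the joint state by a scalar. The
state of all quantum registers is then a function of the classical record, so a classical program
can keep it in its unbounded memory and sample the measurement outcomes from it
(`Program.dequantize`). This gives `classicallySolvableWithin_of_solvableWithin`.

For the four concrete problems it remains to see that the prover has some legitimate oracle on the
accept instance: one that samples from a given distribution (`sampleAccess_nonempty`), and one that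
prepares the maximally mixed state (`copyAccess_maximallyMixed_nonempty`).
-/

noncomputable section

namespace InteractiveTesting

/-! ### Operators on subsystems -/

section Subsystems

theorem applyKraus_posSemidef {t : Type} [Fintype t] (K : Matrix t t ℂ) {ρ : Matrix t t ℂ}
    (hρ : ρ.PosSemidef) :
    (applyKraus K ρ).PosSemidef :=
  hρ.mul_mul_conjTranspose_same K

theorem trace_re_nonneg {t : Type} [Fintype t] {ρ : Matrix t t ℂ}
    (hρ : ρ.PosSemidef) : 0 ≤ ρ.trace.re :=
  (Complex.nonneg_iff.mp hρ.trace_nonneg).1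

theorem trace_re_eq_zero_iff {t : Type} [Fintype t] {ρ : Matrix t t ℂ}
    (hρ : ρ.PosSemidef) :
    ρ.trace.re = 0 ↔ ρ = 0 := by
  rw [← hρ.trace_eq_zero_iff, Complex.ext_iff]
  exact ⟨fun h => ⟨h, (Complex.nonneg_iff.mp hρ.trace_nonneg).2.symm⟩, fun h => h.1⟩

variable {a b t : Type} [Fintype a] [DecidableEq a] [Fintype b] [DecidableEq b]
  [Fintype t] [DecidableEq t]

/-- The action `K ↦ K ⊗ 1` on the first tensor factor, as a star homomorphism. -/
def onFst (a b : Type) [Fintype a] [DecidableEq a] [Fintype b] [DecidableEq b] :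
    Matrix a a ℂ →⋆ₐ[ℂ] Matrix (a × b) (a × b) ℂ where
  toFun K := K ⊗ₖ (1 : Matrix b b ℂ)
  map_one' := one_kronecker_one
  map_mul' K L := by rw [← mul_kronecker_mul, one_mul]
  map_zero' := zero_kronecker _
  map_add' K L := add_kronecker _ _ _
  commutes' r := by simp [Algebra.algebraMap_eq_smul_one, smul_kronecker]
  map_star' K := by simp [star_eq_conjTranspose, conjTranspose_kronecker]

/-- The action `K ↦ 1 ⊗ K` on the second tensor factor, as a star homomorphism. -/
def onSnd (a b : Type) [Fintype a] [DecidableEq a] [Fintype b] [DecidableEq b] :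
    Matrix b b ℂ →⋆ₐ[ℂ] Matrix (a × b) (a × b) ℂ where
  toFun K := (1 : Matrix a a ℂ) ⊗ₖ K
  map_one' := one_kronecker_one
  map_mul' K L := by rw [← mul_kronecker_mul, one_mul]
  map_zero' := kronecker_zero _
  map_add' K L := kronecker_add _ _ _
  commutes' r := by simp [Algebra.algebraMap_eq_smul_one, kronecker_smul]
  map_star' K := by simp [star_eq_conjTranspose, conjTranspose_kronecker]

/-- Renaming the basis labels of a register along a bijection, as a star homomorphism. -/
def relabel (e : a ≃ b) : Matrix a a ℂ →⋆ₐ[ℂ] Matrix b b ℂ where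
  toFun K := K.submatrix e.symm e.symm
  map_one' := submatrix_one_equiv _
  map_mul' K L := (submatrix_mul_equiv K L _ _ _).symm
  map_zero' := rfl
  map_add' K L := rfl
  commutes' r := by
    simp [Algebra.algebraMap_eq_smul_one, submatrix_smul]
  map_star' K := rfl

theorem trace_relabel (e : a ≃ b) (K : Matrix a a ℂ) : (relabel e K).trace = K.trace :=
  Equiv.sum_comp e.symm fun i => K i i

theorem isDensity_relabel (e : a ≃ b) {ρ : Matrix a a ℂ} (h : IsDensity ρ) :
    IsDensity (relabel e ρ) :=
  ⟨h.1.submatrix e.symm, (trace_relabel e ρ).trans h.2⟩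

theorem map_applyKraus (φ : Matrix a a ℂ →⋆ₐ[ℂ] Matrix t t ℂ) (K ρ : Matrix a a ℂ) :
    φ (applyKraus K ρ) = applyKraus (φ K) (φ ρ) := by
  simp only [applyKraus, ← star_eq_conjTranspose, map_mul, map_star]

theorem sum_star_map_mul_map {ι : Type} [Fintype ι] (φ : Matrix a a ℂ →⋆ₐ[ℂ] Matrix t t ℂ)
    (K : ι → Matrix a a ℂ) (hK : ∑ i, (K i)ᴴ * K i = 1) : ∑ i, (φ (K i))ᴴ * φ (K i) = 1 := by
  simp only [← star_eq_conjTranspose, ← map_star, ← map_mul, ← map_sum] at hK ⊢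
  rw [hK, map_one]

/-- A measurement of a subsystem, regarded as a measurement of the whole system. -/
def Measurement.map (M : Measurement a) (φ : Matrix a a ℂ →⋆ₐ[ℂ] Matrix t t ℂ) :
    Measurement t where
  arity := M.arity
  kraus i := φ (M.kraus i)
  complete := sum_star_map_mul_map φ _ M.complete

theorem applyKraus_smul (K : Matrix t t ℂ) (c : ℂ) (ρ : Matrix t t ℂ) :
    applyKraus K (c • ρ) = c • applyKraus K ρ := by
  simp [applyKraus]

theorem sum_trace_applyKraus {ι : Type} [Fintype ι] (K : ι → Matrix t t ℂ)
    (hK : ∑ i, (K i)ᴴ * K i = 1) (ρ : Matrix t t ℂ) :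
    ∑ i, (applyKraus (K i) ρ).trace.re = ρ.trace.re := by
  have h : ∀ i, (applyKraus (K i) ρ).trace = (((K i)ᴴ * K i) * ρ).trace := fun i => by
    rw [applyKraus, trace_mul_cycle]
  simp only [h, ← Complex.re_sum, ← trace_sum, ← Finset.sum_mul, hK, one_mul]

end Subsystems

/-! ### Output probabilities of programs -/

section Run

variable {I : Interface} {W L : Type} [Fintype W] [DecidableEq W]

open Classical in
/-- The weight (unnormalised probability) of the event `E` on the output and the total number of
queries, when a program is run with oracle `O` from query history `h` and unnormalised state `ρ`. -/
def Program.run (O : Oracle I) (E : L → ℕ → Prop) (p : Program I (W × I.Reg) L)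
    (h : History I) (ρ : Matrix (W × I.Reg) (W × I.Reg) ℂ) : ℝ :=
  p.eval O (fun K => K) (fun K => (1 : Matrix W W ℂ) ⊗ₖ K)
    (fun d h ρ => if E d h.length then ρ.trace.re else 0) h ρ

open Classical in
theorem Program.run_done (O : Oracle I) (E : L → ℕ → Prop) (d : L) (h : History I)
    (ρ : Matrix (W × I.Reg) (W × I.Reg) ℂ) :
    (Program.done d).run O E h ρ = if E d h.length then ρ.trace.re else 0 := rfl

theorem Program.run_measure (O : Oracle I) (E : L → ℕ → Prop) (M : Measurement (W × I.Reg))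
    (next : Fin M.arity → Program I (W × I.Reg) L) (h : History I)
    (ρ : Matrix (W × I.Reg) (W × I.Reg) ℂ) :
    (Program.measure M next).run O E h ρ =
      ∑ i, (next i).run O E h (applyKraus (M.kraus i) ρ) := rfl

theorem Program.run_query (O : Oracle I) (E : L → ℕ → Prop) (q : I.Query)
    (next : I.Answer → Program I (W × I.Reg) L) (h : History I)
    (ρ : Matrix (W × I.Reg) (W × I.Reg) ℂ) :
    (Program.query q next).run O E h ρ =
      ∑ j, (next ((O h q).label j)).run O E ((q, (O h q).label j) :: h)
        (applyKraus (onSnd W I.Reg ((O h q).kraus j)) ρ) := rfl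

theorem Program.run_le_add (O : Oracle I) {E E₁ E₂ : L → ℕ → Prop}
    (hE : ∀ d m, E d m → E₁ d m ∨ E₂ d m) (p : Program I (W × I.Reg) L) (h : History I)
    {ρ : Matrix (W × I.Reg) (W × I.Reg) ℂ} (hρ : ρ.PosSemidef) :
    p.run O E h ρ ≤ p.run O E₁ h ρ + p.run O E₂ h ρ := by
  induction p generalizing h ρ with
  | done d =>
    have h0 := trace_re_nonneg hρ
    have := hE d h.length
    simp only [run_done]
    split_ifs <;> first | linarith | tauto
  | measure M next ih =>
    simp only [run_measure, ← Finset.sum_add_distrib]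
    exact Finset.sum_le_sum fun i _ => ih i h (applyKraus_posSemidef _ hρ)
  | query q next ih =>
    simp only [run_query, ← Finset.sum_add_distrib]
    exact Finset.sum_le_sum fun j _ => ih _ _ (applyKraus_posSemidef _ hρ)

theorem Program.run_eq_zero (O : Oracle I) {E : L → ℕ → Prop} (p : Program I (W × I.Reg) L)
    (h : History I) (hE : ∀ d m, h.length ≤ m → ¬ E d m)
    (ρ : Matrix (W × I.Reg) (W × I.Reg) ℂ) : p.run O E h ρ = 0 := by
  induction p generalizing h ρ with
  | done d => rw [run_done, if_neg (hE d _ le_rfl)]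
  | measure M next ih =>
    rw [run_measure]
    exact Finset.sum_eq_zero fun i _ => ih i h hE _
  | query q next ih =>
    rw [run_query]
    exact Finset.sum_eq_zero fun j _ =>
      ih _ _ (fun d m hm => hE d m (by simp only [List.length_cons] at hm; omega)) _

theorem Program.run_mono (O : Oracle I) {E E' : L → ℕ → Prop} (hE : ∀ d m, E d m → E' d m)
    (p : Program I (W × I.Reg) L) (h : History I)
    {ρ : Matrix (W × I.Reg) (W × I.Reg) ℂ} (hρ : ρ.PosSemidef) :
    p.run O E h ρ ≤ p.run O E' h ρ := by
  have h1 := p.run_le_add O (E₁ := E') (E₂ := fun _ _ => False) (fun d m hd => Or.inl (hE d m hd))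
    h hρ
  rwa [p.run_eq_zero O (E := fun _ _ => False) h (fun _ _ _ => id), add_zero] at h1

theorem Program.run_nonneg (O : Oracle I) (E : L → ℕ → Prop) (p : Program I (W × I.Reg) L)
    (h : History I) {ρ : Matrix (W × I.Reg) (W × I.Reg) ℂ} (hρ : ρ.PosSemidef) :
    0 ≤ p.run O E h ρ :=
  (p.run_eq_zero O (E := fun _ _ => False) h (fun _ _ _ => id) ρ).symm.le.trans
    (p.run_mono O (fun _ _ => False.elim) h hρ)

theorem Program.run_true (O : Oracle I) (p : Program I (W × I.Reg) L) (h : History I)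
    (ρ : Matrix (W × I.Reg) (W × I.Reg) ℂ) : p.run O (fun _ _ => True) h ρ = ρ.trace.re := by
  induction p generalizing h ρ with
  | done d => rw [run_done, if_pos trivial]
  | measure M next ih =>
    simp only [run_measure, ih]
    exact sum_trace_applyKraus _ M.complete ρ
  | query q next ih =>
    simp only [run_query, ih]
    exact sum_trace_applyKraus _ (sum_star_map_mul_map (onSnd W I.Reg) _ (O h q).complete) ρ

theorem Program.run_smul (O : Oracle I) (E : L → ℕ → Prop) (p : Program I (W × I.Reg) L)
    (h : History I) (c : ℝ) (ρ : Matrix (W × I.Reg) (W × I.Reg) ℂ) :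
    p.run O E h ((c : ℂ) • ρ) = c * p.run O E h ρ := by
  induction p generalizing h ρ with
  | done d => simp [run_done, trace_smul]
  | measure M next ih => simp only [run_measure, applyKraus_smul, ih, Finset.mul_sum]
  | query q next ih => simp only [run_query, applyKraus_smul, ih, Finset.mul_sum]

/-! ### Enforcing a bound on the number of queries -/

/-- The program that stops with output `b` as soon as `p` tries to make more than `r` queries, and
otherwise postprocesses the output of `p` by `f`. -/
def Program.cutoff {L' : Type} {a : Type} [Fintype a] [DecidableEq a] (f : L → L') (b : L') :
    Program I a L → ℕ → Program I a L'
  | .done x, _ => .done (f x)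
  | .measure M next, r => .measure M fun i => (next i).cutoff f b r
  | .query _ _, 0 => .done b
  | .query q next, r + 1 => .query q fun y => (next y).cutoff f b r

theorem Program.run_cutoff_length_lt {L' : Type} (O : Oracle I) (f : L → L') (b : L')
    (p : Program I (W × I.Reg) L) (r n : ℕ) (h : History I) (hn : h.length + r = n)
    (ρ : Matrix (W × I.Reg) (W × I.Reg) ℂ) :
    (p.cutoff f b r).run O (fun _ m => n < m) h ρ = 0 := by
  induction p generalizing r h ρ with
  | done d => rw [cutoff, run_done, if_neg (by omega)]
  | measure M next ih =>
    rw [cutoff, run_measure]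
    exact Finset.sum_eq_zero fun i _ => ih i r h hn _
  | query q next ih =>
    cases r with
    | zero => rw [cutoff, run_done, if_neg (by omega)]
    | succ r =>
      rw [cutoff, run_query]
      exact Finset.sum_eq_zero fun j _ => ih _ r _ (by simp; omega) _

/-- An output other than the default value `b` occurs only on the branches that respect the
bound on the number of queries. -/
theorem Program.run_cutoff_eq {L' : Type} (O : Oracle I) (f : L → L') {b c : L'} (hbc : b ≠ c)
    (p : Program I (W × I.Reg) L) (r n : ℕ) (h : History I) (hn : h.length + r = n)
    (ρ : Matrix (W × I.Reg) (W × I.Reg) ℂ) :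
    (p.cutoff f b r).run O (fun d _ => d = c) h ρ = p.run O (fun v m => f v = c ∧ m ≤ n) h ρ := by
  induction p generalizing r h ρ with
  | done d =>
    have : h.length ≤ n := by omega
    rw [cutoff, run_done, run_done]
    by_cases hd : f d = c <;> simp [hd, this]
  | measure M next ih =>
    rw [cutoff, run_measure, run_measure]
    exact Finset.sum_congr rfl fun i _ => ih i r h hn _
  | query q next ih =>
    cases r with
    | zero =>
      rw [cutoff, run_done, if_neg hbc, run_query]
      refine (Finset.sum_eq_zero fun j _ => run_eq_zero O _ _ ?_ _).symm
      intro d m hm hd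
      simp only [List.length_cons] at hm
      omega
    | succ r =>
      rw [cutoff, run_query, run_query]
      exact Finset.sum_congr rfl fun j _ => ih _ r _ (by simp; omega) _

end Run

/-! ### Simulating the prover -/

/-- The program `p` of the prover, followed by `k`, as a program of a party that holds a larger
register `t` and has oracle access of another type. The oracle of the prover is known, so that its
responses become measurements; `φ` and `ψ` say how the register of `p` and its oracle register sit
inside `t`. -/
def Program.internalize {I J : Interface} {b t L L' : Type} [Fintype b] [DecidableEq b]
    [Fintype t] [DecidableEq t] (O : Oracle J) (φ : Matrix b b ℂ →⋆ₐ[ℂ] Matrix t t ℂ)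
    (ψ : Matrix J.Reg J.Reg ℂ →⋆ₐ[ℂ] Matrix t t ℂ) (k : L → History J → Program I t L') :
    Program J b L → History J → Program I t L'
  | .done x, g => k x g
  | .measure M next, g => .measure (M.map φ) fun i => (next i).internalize O φ ψ k g
  | .query q next, g => .measure ((O g q).toMeasurement.map ψ) fun j =>
      (next ((O g q).label j)).internalize O φ ψ k ((q, (O g q).label j) :: g)

theorem Program.run_internalize {I J : Interface} {b t W L L' : Type} [Fintype b] [DecidableEq b]
    [Fintype t] [DecidableEq t] [Fintype W] [DecidableEq W] (OV : Oracle I) (O : Oracle J)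
    (E : L' → ℕ → Prop) (r : Matrix t t ℂ →⋆ₐ[ℂ] Matrix (W × I.Reg) (W × I.Reg) ℂ)
    (φ : Matrix b b ℂ →⋆ₐ[ℂ] Matrix t t ℂ) (ψ : Matrix J.Reg J.Reg ℂ →⋆ₐ[ℂ] Matrix t t ℂ)
    (k : L → History J → Program I (W × I.Reg) L') (p : Program J b L) (g : History J)
    (h : History I) (ρ : Matrix t t ℂ) :
    (p.internalize O (r.comp φ) (r.comp ψ) k g).run OV E h (r ρ) =
      p.eval O φ ψ (fun x g' ρ' => (k x g').run OV E h (r ρ')) g ρ := by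
  induction p generalizing g ρ with
  | done x => rfl
  | measure M next ih =>
    rw [internalize, run_measure, eval]
    exact Finset.sum_congr rfl fun (i : Fin M.arity) _ =>
      (congrArg (run OV E _ h) (map_applyKraus r (φ (M.kraus i)) ρ).symm).trans (ih i g _)
  | query q next ih =>
    rw [internalize, run_measure, eval]
    exact Finset.sum_congr rfl fun (j : Fin (O g q).arity) _ =>
      (congrArg (run OV E _ h) (map_applyKraus r (ψ ((O g q).kraus j)) ρ).symm).trans (ih _ _ _)

section Simulation

variable {I J : Interface} {C : Channel} {W : Type} [Fintype W] [DecidableEq W]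

/-- The private register of a party that simulates both the verifier and the prover. -/
abbrev SimWork (W : Type) (C : Channel) (P : Prover J C) : Type :=
  (W × C.Reg) × (P.Work × J.Reg)

/-- The joint register of verifier and prover, with the oracle register of the verifier moved to
the end. -/
def jointEquiv (W : Type) (I : Interface) (C : Channel) (P : Prover J C) :
    Joint W I C P ≃ SimWork W C P × I.Reg where
  toFun z := (((z.1.1.1, z.1.2), z.2), z.1.1.2)
  invFun z := (((z.1.1.1, z.2), z.1.1.2), z.1.2)
  left_inv _ := rfl
  right_inv _ := rfl

theorem relabel_jointEquiv_onSnd (P : Prover J C) (K : Matrix I.Reg I.Reg ℂ) :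
    relabel (jointEquiv W I C P) ((((1 : Matrix W W ℂ) ⊗ₖ K) ⊗ₖ (1 : Matrix C.Reg C.Reg ℂ)) ⊗ₖ
      (1 : Matrix (P.Work × J.Reg) (P.Work × J.Reg) ℂ)) = onSnd (SimWork W C P) I.Reg K := by
  ext ⟨⟨⟨w, c⟩, p⟩, i⟩ ⟨⟨⟨w', c'⟩, p'⟩, i'⟩
  simp only [relabel, onSnd, StarAlgHom.coe_mk', AlgHom.coe_mk, RingHom.coe_mk, MonoidHom.coe_mk,
    OneHom.coe_mk, jointEquiv, Equiv.coe_fn_symm_mk, submatrix_apply, kroneckerMap_apply,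
    one_apply, Prod.mk.injEq]
  by_cases hw : w = w' <;> by_cases hc : c = c' <;> by_cases hp : p = p' <;> simp [hw, hc, hp]

/-- The interaction of a verifier with the prover `P`, whose oracle is `OP`, as a single program
that has access to the oracle of the verifier only. -/
def VerifierProgram.simulate (P : Prover J C) (OP : Oracle J) :
    VerifierProgram I C ((W × I.Reg) × C.Reg) → P.Mem → History J →
      Program I (SimWork W C P × I.Reg) (Option Decision)
  | .halt v, _, _ => .done v
  | .measure M next, s, g =>
      .measure (M.map ((relabel (jointEquiv W I C P)).comp
        (onFst ((W × I.Reg) × C.Reg) (P.Work × J.Reg)))) fun i => (next i).simulate P OP s g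
  | .query q next, s, g => .query q fun y => (next y).simulate P OP s g
  | .send c next, s, g =>
      (P.turn s c).internalize OP
        ((relabel (jointEquiv W I C P)).comp
          ((relabel (Equiv.prodAssoc (W × I.Reg) C.Reg (P.Work × J.Reg)).symm).comp
            (onSnd (W × I.Reg) (C.Reg × (P.Work × J.Reg)))))
        ((relabel (jointEquiv W I C P)).comp
          ((onSnd ((W × I.Reg) × C.Reg) (P.Work × J.Reg)).comp (onSnd P.Work J.Reg)))
        (fun r g' => (next r.2).simulate P OP r.1 g') g

theorem VerifierProgram.run_simulate (OV : Oracle I) (P : Prover J C) (OP : Oracle J)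
    (E : Option Decision → ℕ → Prop) (p : VerifierProgram I C ((W × I.Reg) × C.Reg))
    (h : History I) (s : P.Mem) (g : History J) (ρ : Matrix (Joint W I C P) (Joint W I C P) ℂ) :
    (p.simulate P OP s g).run OV E h (relabel (jointEquiv W I C P) ρ) =
      p.eval OV P OP E h s g ρ := by
  induction p generalizing h s g ρ with
  | halt v => rw [simulate, Program.run_done, trace_relabel, eval]
  | measure M next ih =>
    rw [simulate, Program.run_measure, eval]
    refine Finset.sum_congr rfl fun (i : Fin M.arity) _ => ?_
    rw [← ih]
    exact congrArg _ (map_applyKraus (relabel (jointEquiv W I C P)) (onFst _ _ (M.kraus i)) ρ).symm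
  | query q next ih =>
    rw [simulate, Program.run_query, eval]
    refine Finset.sum_congr rfl fun j _ => ?_
    rw [← ih, map_applyKraus, relabel_jointEquiv_onSnd]
  | send c next ih =>
    rw [simulate, Program.run_internalize, eval]
    simp only [ih]
    rfl

/-- A lone algorithm that runs the verifier against a simulated prover with oracle `OP`, stops with
"reject" before its `(n+1)`-st query, and accepts only if the verifier does so. -/
def Verifier.alone (V : Verifier I C) (P : Prover J C) (OP : Oracle J) (n : ℕ) : Algorithm I where
  Work := SimWork V.Work C P
  start := relabel (jointEquiv V.Work I C P) (V.start ⊗ₖ P.start)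
  isDensity := isDensity_relabel _ ⟨V.isDensity.1.kronecker P.isDensity.1, by
    rw [trace_kronecker, V.isDensity.2, P.isDensity.2, one_mul]⟩
  program := (V.program.simulate P OP P.init []).cutoff (fun v => v.getD .reject) .reject n

theorem Algorithm.prob_eq_run (A : Algorithm I) (O : Oracle I) (E : Decision → ℕ → Prop) :
    A.prob O E = A.program.run O E [] A.start := rfl

theorem Verifier.run_simulate (V : Verifier I C) (OV : Oracle I) (P : Prover J C) (OP : Oracle J)
    (n : ℕ) (E : Option Decision → ℕ → Prop) :
    (V.program.simulate P OP P.init []).run OV E [] (V.alone P OP n).start =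
      V.prob OV P OP E :=
  V.program.run_simulate OV P OP E [] P.init [] (V.start ⊗ₖ P.start)

theorem Verifier.alone_prob_accept (V : Verifier I C) (OV : Oracle I) (P : Prover J C)
    (OP : Oracle J) (n : ℕ) :
    (V.alone P OP n).prob OV (fun d _ => d = .accept) =
      V.prob OV P OP (fun v m => v = some .accept ∧ m ≤ n) := by
  rw [← V.run_simulate OV P OP n, Algorithm.prob_eq_run]
  refine (Program.run_cutoff_eq OV _ Decision.noConfusion _ n n [] (by simp) _).trans ?_
  refine congrArg (fun E => Program.run OV E _ _ _) (funext₂ fun v m => propext ?_)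
  rcases v with _ | _ | _ <;> simp

/-- Any oracle that is legitimate for the accept instance lets a lone algorithm replace the prover
on every instance. -/
theorem solvableWithin_of_verifiableWithin {X : Type*} (T : ManyVsOne X) (accV : AccessModel I X)
    (accP : AccessModel J X) (δ : ℝ) (n : ℕ) (hP : (accP T.accept).Nonempty)
    (hV : VerifiableWithin T accV accP δ n) : SolvableWithin T accV δ n := by
  obtain ⟨C, V, P, ⟨hcomplete, hsound⟩, hn⟩ := hV
  obtain ⟨OP, hOP⟩ := hP
  set A := V.alone P OP n with hA
  have hpos : A.start.PosSemidef := A.isDensity.1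
  refine ⟨A, fun x O hO => ?_, fun x O _ => ?_⟩
  · by_cases hx : x = T.accept
    · subst hx
      calc 1 - δ ≤ V.prob O P OP (fun v _ => ∃ d, v = some d ∧ T.Valid d T.accept) :=
            hcomplete _ O hO OP hOP
        _ ≤ V.prob O P OP (fun v m => v = some .accept ∧ m ≤ n) +
              V.prob O P OP (fun _ m => n < m) := by
            simp only [← V.run_simulate O P OP n]
            refine Program.run_le_add O ?_ _ _ hpos
            rintro v m ⟨d | d, rfl, hd⟩
            · exact (le_or_gt m n).imp (fun h => ⟨rfl, h⟩) id
            · exact absurd rfl hd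
        _ = A.prob O (fun d _ => d = .accept) := by
            rw [hn _ O hO OP hOP, add_zero, hA, V.alone_prob_accept]
        _ ≤ A.prob O (fun d _ => T.Valid d T.accept) := by
            simp only [Algorithm.prob_eq_run]
            refine Program.run_mono O ?_ _ _ hpos
            rintro d m rfl
            exact T.accept_notMem
    · have hbad := hsound x O hO J P OP
      have htrue : A.prob O (fun _ _ => True) = 1 := by
        rw [Algorithm.prob_eq_run, Program.run_true, A.isDensity.2, Complex.one_re]
      by_cases hR : x ∈ T.reject
      · have h1 : A.prob O (fun d _ => d = .accept) ≤
            V.prob O P OP (fun v _ => ∃ d, v = some d ∧ ¬ T.Valid d x) := by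
          rw [hA, V.alone_prob_accept]
          simp only [← V.run_simulate O P OP n]
          refine Program.run_mono O ?_ _ _ hpos
          rintro v m ⟨rfl, -⟩
          exact ⟨_, rfl, not_not_intro hR⟩
        have h2 : A.prob O (fun _ _ => True) ≤
            A.prob O (fun d _ => d = .accept) + A.prob O (fun d _ => T.Valid d x) := by
          simp only [Algorithm.prob_eq_run]
          refine Program.run_le_add O ?_ _ _ hpos
          rintro (_ | _) m -
          · exact Or.inl rfl
          · exact Or.inr hx
        linarith
      · -- Every output is valid here; that `δ` is positive is a consequence of soundness.
        have h1 : 0 ≤ V.prob O P OP (fun v _ => ∃ d, v = some d ∧ ¬ T.Valid d x) := by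
          rw [← V.run_simulate O P OP n]
          exact Program.run_nonneg O _ _ _ hpos
        have h2 : A.prob O (fun _ _ => True) ≤ A.prob O (fun d _ => T.Valid d x) := by
          simp only [Algorithm.prob_eq_run]
          refine Program.run_mono O ?_ _ _ hpos
          rintro (_ | _) m -
          · exact hR
          · exact hx
        linarith
  · exact Program.run_cutoff_length_lt O _ _ _ n n [] (by simp) _

end Simulation

/-! ### Replacing quantum memory by classical randomness -/

section Dequantization

theorem applyKraus_smul_one {t : Type} [Fintype t] [DecidableEq t] (c : ℂ) (ρ : Matrix t t ℂ) :
    applyKraus (c • 1) ρ = ((Complex.normSq c : ℝ) : ℂ) • ρ := by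
  simp [applyKraus, conjTranspose_smul, smul_smul, Complex.normSq_eq_conj_mul_self]

theorem exists_eq_smul_one {r : Type} [DecidableEq r] [Subsingleton r]
    (K : Matrix r r ℂ) : ∃ c : ℂ, K = c • 1 := by
  cases isEmpty_or_nonempty r
  · exact ⟨0, Subsingleton.elim _ _⟩
  · inhabit r
    refine ⟨K default default, ?_⟩
    ext i j
    simp [Subsingleton.elim i default, Subsingleton.elim j default]

/-- The random choice of an outcome with probabilities `p`, as a measurement that leaves the state
of the register unchanged. -/
def coin {a : Type} [Fintype a] [DecidableEq a] {n : ℕ} (p : Fin n → ℝ) (hp : ∀ i, 0 ≤ p i)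
    (hsum : ∑ i, p i = 1) : Measurement a where
  arity := n
  kraus i := ((Real.sqrt (p i) : ℝ) : ℂ) • 1
  complete := by
    have h : ∀ i, (((Real.sqrt (p i) : ℝ) : ℂ) • (1 : Matrix a a ℂ))ᴴ *
        (((Real.sqrt (p i) : ℝ) : ℂ) • 1) = ((p i : ℝ) : ℂ) • 1 := fun i => by
      simp [conjTranspose_smul, smul_smul, Real.mul_self_sqrt (hp i)]
    simp_rw [h, ← Finset.sum_smul, ← Complex.ofReal_sum, hsum, Complex.ofReal_one, one_smul]

variable {I : Interface} {W L : Type} [Fintype W] [DecidableEq W]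

/-- The coin that shows `i` with the probability of outcome `i` when `M` is applied to the
unnormalised state `ρ`. The register `a` that carries the coin is unrelated to that of `ρ`. -/
def outcomeCoin {a t : Type} [Fintype a] [DecidableEq a] [Fintype t] [DecidableEq t]
    (M : Measurement t) {ρ : Matrix t t ℂ} (hρ : ρ.PosSemidef ∧ ρ.trace.re ≠ 0) :
    Measurement a :=
  coin (fun i => (applyKraus (M.kraus i) ρ).trace.re / ρ.trace.re)
    (fun _ => div_nonneg (trace_re_nonneg (applyKraus_posSemidef _ hρ.1)) (trace_re_nonneg hρ.1))
    (by rw [← Finset.sum_div, sum_trace_applyKraus _ M.complete, div_self hρ.2])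

open Classical in
/-- The classical randomised program that computes the quantum state `ρ` of the program `p` and
tosses coins in place of the measurements. Responses of a classical oracle do not change the
normalised state of the other registers, hence queries are just passed on. On branches of
probability zero the output is irrelevant and set to `b`. -/
def Program.dequantize (b : L) : Program I (W × I.Reg) L →
    Matrix (W × I.Reg) (W × I.Reg) ℂ → Program I (Unit × I.Reg) L
  | .done x, _ => .done x
  | .measure M next, ρ =>
      if hρ : ρ.PosSemidef ∧ ρ.trace.re ≠ 0 then
        .measure (outcomeCoin M hρ) fun i => (next i).dequantize b (applyKraus (M.kraus i) ρ)
      else .done b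
  | .query q next, ρ => .query q fun y => (next y).dequantize b ρ

/-- Running the dequantized program on `σ` has the same effect as running the original one on the
state `ρ` that is kept in memory, up to the normalisation of `σ` and `ρ`. -/
theorem Program.run_dequantize [Subsingleton I.Reg] (O : Oracle I) (E : L → ℕ → Prop) (b : L)
    (p : Program I (W × I.Reg) L) (h : History I) {ρ : Matrix (W × I.Reg) (W × I.Reg) ℂ}
    (hρ : ρ.PosSemidef) (σ : Matrix (Unit × I.Reg) (Unit × I.Reg) ℂ) :
    (p.dequantize b ρ).run O E h σ * ρ.trace.re = σ.trace.re * p.run O E h ρ := by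
  induction p generalizing h ρ σ with
  | done d =>
    simp only [dequantize, run_done]
    split_ifs <;> ring
  | measure M next ih =>
    by_cases h0 : ρ.trace.re = 0
    · -- The state vanishes, and with it the weight of every event.
      rw [h0, mul_zero, (trace_re_eq_zero_iff hρ).mp h0]
      have hz := (Program.measure M next).run_smul O E h 0 0
      rw [smul_zero, zero_mul] at hz
      rw [hz, mul_zero]
    · rw [dequantize, dif_pos ⟨hρ, h0⟩, run_measure, run_measure, Finset.sum_mul, Finset.mul_sum]
      refine Finset.sum_congr rfl fun (i : Fin M.arity) _ => ?_
      have hpos := applyKraus_posSemidef (M.kraus i) hρ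
      have hσ : applyKraus ((outcomeCoin (a := Unit × I.Reg) M ⟨hρ, h0⟩).kraus i) σ =
          (((applyKraus (M.kraus i) ρ).trace.re / ρ.trace.re : ℝ) : ℂ) • σ := by
        refine (applyKraus_smul_one _ _).trans ?_
        rw [Complex.normSq_ofReal, Real.mul_self_sqrt
          (div_nonneg (trace_re_nonneg hpos) (trace_re_nonneg hρ))]
      rw [hσ, run_smul, ← ih i h hpos σ]
      field_simp
  | query q next ih =>
    simp only [dequantize, run_query, Finset.sum_mul, Finset.mul_sum]
    refine Finset.sum_congr rfl fun j _ => ?_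
    obtain ⟨c, hc⟩ := exists_eq_smul_one ((O h q).kraus j)
    simp only [hc, map_smul, map_one, applyKraus_smul_one, run_smul]
    linear_combination Complex.normSq c * ih _ ((q, (O h q).label j) :: h) hρ σ

/-- With access to a classical oracle, every algorithm can be replaced by a classical one. -/
theorem classicallySolvableWithin_of_solvableWithin {X : Type*} [Subsingleton I.Reg]
    (T : ManyVsOne X) (acc : AccessModel I X) (δ : ℝ) (n : ℕ) (hA : SolvableWithin T acc δ n) :
    ClassicallySolvableWithin T acc δ n := by
  obtain ⟨A, hsolves, hqueries⟩ := hA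
  have hne : Nonempty (A.Work × I.Reg) := by
    by_contra hempty
    rw [not_nonempty_iff] at hempty
    simpa [trace] using A.isDensity.2
  have : Nonempty I.Reg := hne.map Prod.snd
  have := Fintype.card_le_one_iff_subsingleton.mpr ‹Subsingleton I.Reg›
  have hcard : Fintype.card I.Reg = 1 := le_antisymm this Fintype.card_pos
  let B : Algorithm I :=
    { Work := Unit
      start := 1
      isDensity := ⟨PosSemidef.one, by simp [hcard]⟩
      program := A.program.dequantize .reject A.start }
  have hprob : ∀ O E, B.prob O E = A.prob O E := fun O E => by
    have h := A.program.run_dequantize O E .reject [] A.isDensity.1 B.start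
    rw [A.isDensity.2, B.isDensity.2, Complex.one_re, mul_one, one_mul] at h
    exact h
  refine ⟨B, inferInstanceAs (Subsingleton (Unit × I.Reg)), fun x O hO => ?_, fun x O hO => ?_⟩
  · rw [hprob]
    exact hsolves x O hO
  · rw [hprob]
    exact hqueries x O hO

end Dequantization

/-! ### Oracles for the accept instances -/

/-- The oracle tosses a coin whose faces are the elements of `Ω`, weighted by `D`. -/
theorem sampleAccess_nonempty {Ω : Type} [Fintype Ω] [DecidableEq Ω] (D : PMF Ω) :
    (sampleAccess Ω D).Nonempty := by
  let e := (Fintype.equivFin Ω).symm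
  have hsum : ∑ i, (D (e i)).toReal = 1 := by
    rw [e.sum_comp fun ω => (D ω).toReal, ← ENNReal.toReal_sum fun ω _ => D.apply_ne_top ω,
      ← tsum_fintype (L := .unconditional Ω), D.tsum_coe, ENNReal.toReal_one]
  refine ⟨fun _ _ => ⟨coin (fun i => (D (e i)).toReal) (fun _ => ENNReal.toReal_nonneg) hsum, e⟩,
    fun _ _ ω => ?_⟩
  refine (Finset.sum_eq_single (e.symm ω) (fun i _ hi => if_neg ?_)
    fun h => absurd (Finset.mem_univ _) h).trans ?_
  · rintro rfl
    simp at hi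
  · rw [if_pos (e.apply_symm_apply ω)]
    simp [coin, smul_smul]

/-- The oracle with the Kraus operators `d^{-1/2} |i⟩⟨j|` replaces its register by the maximally
mixed state. -/
theorem copyAccess_maximallyMixed_nonempty (a : Type) [Fintype a] [DecidableEq a] [Nonempty a] :
    (copyAccess a (maximallyMixed a)).Nonempty := by
  let e := (Fintype.equivFin (a × a)).symm
  let c : ℂ := ((Real.sqrt (Fintype.card a : ℝ)⁻¹ : ℝ) : ℂ)
  have hc : c * c = (Fintype.card a : ℂ)⁻¹ := by
    rw [← Complex.ofReal_mul, Real.mul_self_sqrt (by positivity)]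
    simp
  have hstar : star c = c := Complex.conj_ofReal _
  let K : a × a → Matrix a a ℂ := fun p => Matrix.single p.1 p.2 c
  refine ⟨fun _ _ => ⟨⟨Fintype.card (a × a), fun i => K (e i), ?_⟩, fun _ => ()⟩, fun _ _ Y => ?_⟩
  · rw [e.sum_comp fun p => (K p)ᴴ * K p, Fintype.sum_prod_type]
    simp only [K, conjTranspose_single, single_mul_single_same, hstar, hc]
    simp [sum_single_eq_diagonal, ← smul_one_eq_diagonal, smul_smul, ← Nat.cast_smul_eq_nsmul ℂ]
  · refine (e.sum_comp fun p => applyKraus (K p) Y).trans ?_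
    rw [Fintype.sum_prod_type_right]
    simp only [K, applyKraus, conjTranspose_single, single_mul_mul_single, hstar,
      sum_single_eq_diagonal, ← smul_one_eq_diagonal, ← Finset.sum_smul]
    rw [maximallyMixed, smul_smul, ← hc, trace, Finset.sum_mul]
    exact congrArg (· • (1 : Matrix a a ℂ)) (Finset.sum_congr rfl fun i _ => by
      rw [diag_apply]; ring)

end InteractiveTesting

end

theorem corollary3 :
    -- No verifier gains from a prover, whatever the two forms of oracle access are.
    (∀ (X : Type*) (T : ManyVsOne X) (I J : Interface)
        (accV : AccessModel I X) (accP : AccessModel J X) (δ : ℝ) (n : ℕ),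
        (accP T.accept).Nonempty →
        VerifiableWithin T accV accP δ n →
          SolvableWithin T accV δ n ∧
          -- If the verifier's oracle is classical, then even a classical algorithm does as well.
          (Subsingleton I.Reg → ClassicallySolvableWithin T accV δ n)) ∧
    -- Parity testing: statistical queries versus samples.
    (∀ (k : ℕ) (τ δ : ℝ) (n : ℕ), 0 ≤ τ →
        VerifiableWithin (parityTesting k) (sqAccess (Bits (k + 1)) τ)
          (sampleAccess (Bits (k + 1))) δ n →
        ClassicallySolvableWithin (parityTesting k) (sqAccess (Bits (k + 1)) τ) δ n) ∧
    -- Purity testing: quantum statistical queries versus copies.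
    (∀ (d : ℕ) [Nontrivial (Fin d)] (τ δ : ℝ) (n : ℕ), 0 ≤ τ →
        VerifiableWithin (purityTesting d) (qsqAccess (Fin d) τ) (copyAccess (Fin d)) δ n →
        ClassicallySolvableWithin (purityTesting d) (qsqAccess (Fin d) τ) δ n) ∧
    -- Stabilizer testing: quantum statistical queries versus copies.
    (∀ (k : ℕ) [NeZero k] (τ δ : ℝ) (n : ℕ), 0 ≤ τ →
        VerifiableWithin (stabilizerTesting k) (qsqAccess (Bits k) τ) (copyAccess (Bits k)) δ n →
        ClassicallySolvableWithin (stabilizerTesting k) (qsqAccess (Bits k) τ) δ n) ∧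
    -- Quadratic function testing: quantum statistical queries versus copies.
    (∀ (k : ℕ) (τ δ : ℝ) (n : ℕ), 0 ≤ τ →
        VerifiableWithin (quadraticTesting k) (qsqAccess (Bits (k + 1)) τ)
          (copyAccess (Bits (k + 1))) δ n →
        ClassicallySolvableWithin (quadraticTesting k) (qsqAccess (Bits (k + 1)) τ) δ n) := by
  refine ⟨fun X T I J accV accP δ n hP hV => ?_, fun k τ δ n _ hV => ?_, fun d _ τ δ n _ hV => ?_,
    fun k _ τ δ n _ hV => ?_, fun k τ δ n _ hV => ?_⟩
  · have hS := solvableWithin_of_verifiableWithin T accV accP δ n hP hV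
    exact ⟨hS, fun _ => classicallySolvableWithin_of_solvableWithin T accV δ n hS⟩
  · exact classicallySolvableWithin_of_solvableWithin _ _ δ n
      (solvableWithin_of_verifiableWithin _ _ _ δ n (sampleAccess_nonempty _) hV)
  · exact classicallySolvableWithin_of_solvableWithin _ _ δ n
      (solvableWithin_of_verifiableWithin _ _ _ δ n (copyAccess_maximallyMixed_nonempty _) hV)
  · have : Nonempty (Fin k) := ⟨0⟩
    exact classicallySolvableWithin_of_solvableWithin _ _ δ n
      (solvableWithin_of_verifiableWithin _ _ _ δ n (copyAccess_maximallyMixed_nonempty _) hV)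
  · exact classicallySolvableWithin_of_solvableWithin _ _ δ n
      (solvableWithin_of_verifiableWithin _ _ _ δ n (copyAccess_maximallyMixed_nonempty _) hV)
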